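/- Let $0<\mu<L$, let $f:\mathbb{R}^d\to\mathbb{R}$ be continuously differentiable and $\mu$-strongly convex with $L$-Lipschitz gradient, let $x_*$ be its unique minimizer, $f_*=f(x_*)$ and $\kappa=L/\mu$. Let $\alpha\in(0,2/L)$, $x_0\in\mathbb{R}^d$, and consider gradient descent with noisy gradients, $x_{k+1}=x_k-\alpha(\nabla f(x_k)+w_{k+1})$, $k\ge 0$, where $\mathcal{F}_k$ is the $\sigma$-algebra generated by $x_0,\dots,x_k$ and, for some $\sigma>0$, each $w_{k+1}$ is $\mathcal{F}_{k+1}$-measurable with $\mathbb{P}(\|w_{k+1}\|\ge t\mid\mathcal{F}_k)\le 2e^{-t^2/(2\sigma^2)}$ almost surely, for all $t\ge0$ and all $k\ge 0$ (the noise may be biased). For $K\ge0$ and $\theta>0$ let $$R_K(\theta)=\frac{2\sigma^2}{(K+1)\theta}\log\mathbb{E}\Big[e^{\frac{\theta}{2\sigma^2}S_K}\Big],\qquad S_K=\sum_{k=0}^K\big(f(x_k)-f_*\big).$$ Put $\rho=\rho_{GD}(\alpha)=\max\{|1-\alpha\mu|,|1-\alpha L|\}$; $s=1$ if $\alpha\le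 1/L$ and $s=\frac{2-\alpha L}{\alpha L}$ if $\alpha>1/L$; $\delta=2\mu\alpha(1-\frac{L\alpha}{2})-\alpha\mu|1-\alpha L|s$; $r=\alpha\big(\frac{L}{2}\alpha+\frac{|1-\alpha L|}{2s}\big)$; $$\overline{H}_\infty=\begin{cases}\frac{1}{\sqrt{2\mu}}, & 0<\alpha\le\frac1L,\\[2pt] \frac{1}{\sqrt{2\mu}}\frac{\alpha L}{2-\alpha L}, & \frac1L<\alpha\le\frac{2}{L+\sqrt{L\mu}},\\[2pt] \frac{1}{\sqrt{2\mu}}\sqrt{\kappa}, & \frac{2}{L+\sqrt{L\mu}}<\alpha\le\frac{2}{L+\mu},\\[2pt] \frac{\alpha\sqrt{L}}{\sqrt2(2-\alpha L)}, & \frac{2}{L+\mu}<\alpha<\frac2L;\end{cases}$$ $$a^{(1)}_{j,K}=\frac{1-\rho^{K-j+1}}{1-\rho},\qquad a^{(2)}_{j,K}=\frac{1-(1-\delta)^{K-j+1}}{\delta},\qquad j=1,\dots,K;$$ $$\overline R^{(1)}_K(\theta)=\frac{L}{2(K+1)}\left(\frac{1-\rho^{K+1}}{1-\rho}\|x_0-x_*\|^2+\frac{4\sigma^2}{L\theta}\sum_{j=1}^K\log\frac{2+\frac{\theta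 L\alpha^2}{1-\rho}a^{(1)}_{j,K}}{2-\frac{\theta L\alpha^2}{1-\rho}a^{(1)}_{j,K}}\right),$$ $$\overline R^{(2)}_K(\theta)=\frac{1}{K+1}\left(\frac{1-(1-\delta)^{K+1}}{\delta}\big(f(x_0)-f_*\big)+\frac{2\sigma^2}{\theta}\sum_{j=1}^K\log\frac{1+\theta a^{(2)}_{j,K}r}{1-\theta a^{(2)}_{j,K}r}\right),$$ where $\overline R^{(1)}_K(\theta)$ (respectively $\overline R^{(2)}_K(\theta)$) is understood to be $+\infty$ if some denominator inside its logarithms is not positive. Then, for every $K\ge0$ and every $\theta\in(0,1/\overline{H}_\infty^2)$, the expectation defining $R_K(\theta)$ is finite and $$R_K(\theta)\le\min\big\{\overline R^{(1)}_K(\theta),\overline R^{(2)}_K(\theta)\big\}<+\infty.$$ -/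

import Mathlib

open MeasureTheory ProbabilityTheory

/-- The class of `μ`-strongly convex and `L`-smooth functions on `ℝ^d`. -/
structure IsStronglyConvexSmooth {d : ℕ} (μ L : ℝ) (f : EuclideanSpace ℝ (Fin d) → ℝ) :
    Prop where
  strongConvex : ConvexOn ℝ Set.univ (fun x => f x - 1 / 2 * μ * ‖x‖ ^ 2)
  contDiff : ContDiff ℝ 1 f
  lipschitz_gradient : ∀ x y, ‖gradient f x - gradient f y‖ ≤ L * ‖x - y‖

/-- Gradient descent with additive gradient errors, from the (deterministic) point `x₀`:
`x_{k+1} = x_k - α (∇f(x_k) + w_{k+1})`. The value `w 0` is never used. -/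
noncomputable def gdIter {d : ℕ} {Ω : Type*} (f : EuclideanSpace ℝ (Fin d) → ℝ) (α : ℝ)
    (x₀ : EuclideanSpace ℝ (Fin d)) (w : ℕ → Ω → EuclideanSpace ℝ (Fin d)) :
    ℕ → Ω → EuclideanSpace ℝ (Fin d)
  | 0 => fun _ => x₀
  | k + 1 => fun ω =>
      gdIter f α x₀ w k ω - α • (gradient f (gdIter f α x₀ w k ω) + w (k + 1) ω)

/-- The σ-algebra `ℱ_k` generated by the iterates `x_0, …, x_k`. -/
@[reducible] def iterSigma {d : ℕ} {Ω : Type*} (x : ℕ → Ω → EuclideanSpace ℝ (Fin d)) (k : ℕ) :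
    MeasurableSpace Ω :=
  ⨆ j ≤ k, MeasurableSpace.comap (x j) inferInstance

/-- Light-tailed, possibly biased gradient noise: `w_{k+1}` is a random vector that is
`ℱ_{k+1}`-measurable, and `P(‖w_{k+1}‖ ≥ t | ℱ_k) ≤ 2 exp(-t² / (2σ²))` almost surely for every
`t ≥ 0`, where `ℱ_k` is generated by the iterates `x_0, …, x_k`. -/
structure IsSubGaussianNoise {d : ℕ} {Ω : Type*} [MeasurableSpace Ω] (P : Measure Ω)
    (x w : ℕ → Ω → EuclideanSpace ℝ (Fin d)) (σ : ℝ) : Prop where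
  measurable : ∀ k, Measurable (w (k + 1))
  adapted : ∀ k, Measurable[iterSigma x (k + 1)] (w (k + 1))
  tail : ∀ k, ∀ t : ℝ, 0 ≤ t →
    P⟦{ω | t ≤ ‖w (k + 1) ω‖} | iterSigma x k⟧
      ≤ᵐ[P] fun _ => 2 * Real.exp (-t ^ 2 / (2 * σ ^ 2))

/-- The cumulative suboptimality `S_K = ∑_{k=0}^K (f(x_k) - f_*)`. -/
noncomputable def cumSubopt {d : ℕ} {Ω : Type*} (f : EuclideanSpace ℝ (Fin d) → ℝ)
    (fstar : ℝ) (x : ℕ → Ω → EuclideanSpace ℝ (Fin d)) (K : ℕ) (ω : Ω) : ℝ :=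
  ∑ k ∈ Finset.range (K + 1), (f (x k ω) - fstar)

/-- The risk-sensitive cost `R_K(θ) = 2σ² / ((K+1) θ) * log E[exp(θ / (2σ²) * S)]` of a
cumulative cost `S`, meaningful when the exponential is integrable. -/
noncomputable def riskCost {Ω : Type*} [MeasurableSpace Ω] (P : Measure Ω) (S : Ω → ℝ)
    (σ θ : ℝ) (K : ℕ) : ℝ :=
  2 * σ ^ 2 / ((K + 1) * θ) * Real.log (∫ ω, Real.exp (θ / (2 * σ ^ 2) * S ω) ∂P)

/-- The bound `H̄_∞` for gradient descent (with `κ = L / μ`). -/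
noncomputable def gdHbar (μ L α : ℝ) : ℝ :=
  if α ≤ 1 / L then 1 / √(2 * μ)
  else if α ≤ 2 / (L + √(L * μ)) then 1 / √(2 * μ) * (α * L / (2 - α * L))
  else if α ≤ 2 / (L + μ) then 1 / √(2 * μ) * √(L / μ)
  else α * √L / (√2 * (2 - α * L))

/-- The rate `ρ_GD(α)`. -/
noncomputable def gdRho (μ L α : ℝ) : ℝ := max |1 - α * μ| |1 - α * L|

/-- The coefficient `a^{(1)}_{j,K}`, for `1 ≤ j ≤ K`. -/
noncomputable def gdCoeff₁ (μ L α : ℝ) (K j : ℕ) : ℝ :=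
  (1 - gdRho μ L α ^ (K - j + 1)) / (1 - gdRho μ L α)

/-- The parameter `s_GD`. -/
noncomputable def gdS (L α : ℝ) : ℝ :=
  if α ≤ 1 / L then 1 else (2 - α * L) / (α * L)

/-- `2μα(1 - Lα/2) - αμ|1 - αL| s_GD`. -/
noncomputable def gdGap (μ L α : ℝ) : ℝ :=
  2 * μ * α * (1 - L * α / 2) - α * μ * |1 - α * L| * gdS L α

/-- The coefficient `a^{(2)}_{j,K}`, for `1 ≤ j ≤ K`. -/
noncomputable def gdCoeff₂ (μ L α : ℝ) (K j : ℕ) : ℝ :=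
  (1 - (1 - gdGap μ L α) ^ (K - j + 1)) / gdGap μ L α

/-- The bound coming from `‖x - x_*‖²`; `D` is `‖x_0 - x_*‖²`. It is `+∞` when one of the
logarithms is undefined. -/
noncomputable def gdBound₁ (μ L α σ θ D : ℝ) (K : ℕ) : EReal :=
  open Classical in
  if ∀ j ∈ Finset.Icc 1 K,
      0 < 2 - θ * L * α ^ 2 / (1 - gdRho μ L α) * gdCoeff₁ μ L α K j then
    ((L / (2 * (K + 1)) *
      ((1 - gdRho μ L α ^ (K + 1)) / (1 - gdRho μ L α) * D
        + 4 * σ ^ 2 / (L * θ) * ∑ j ∈ Finset.Icc 1 K,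
          Real.log
            ((2 + θ * L * α ^ 2 / (1 - gdRho μ L α) * gdCoeff₁ μ L α K j)
              / (2 - θ * L * α ^ 2 / (1 - gdRho μ L α) * gdCoeff₁ μ L α K j))) : ℝ) : EReal)
  else ⊤

/-- The bound coming from `f - f_*`; `Δ` is `f(x_0) - f_*`. It is `+∞` when one of the
logarithms is undefined. -/
noncomputable def gdBound₂ (μ L α σ θ Δ : ℝ) (K : ℕ) : EReal :=
  open Classical in
  if ∀ j ∈ Finset.Icc 1 K,
      0 < 1 - θ * gdCoeff₂ μ L α K j
        * (α * (L / 2 * α + |1 - α * L| / (2 * gdS L α))) then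
    ((1 / (K + 1) *
      ((1 - (1 - gdGap μ L α) ^ (K + 1)) / gdGap μ L α * Δ
        + 2 * σ ^ 2 / θ * ∑ j ∈ Finset.Icc 1 K,
          Real.log
            ((1 + θ * gdCoeff₂ μ L α K j
                * (α * (L / 2 * α + |1 - α * L| / (2 * gdS L α))))
              / (1 - θ * gdCoeff₂ μ L α K j
                * (α * (L / 2 * α + |1 - α * L| / (2 * gdS L α)))))) : ℝ) : EReal)
  else ⊤

/-!
Along noisy gradient descent, two Lyapunov functions satisfy a scalar recursion
`V (k + 1) ≤ q * V k + b * ‖w (k + 1)‖ ^ 2` with `q < 1`: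

* `‖x_k - x_*‖ ^ 2`, with `q = gdRho μ L α`, because a noiseless step contracts distances by
  `gdRho` (`norm_gradient_step_le`, from cocoercivity of the gradient of `f - μ / 2 * ‖·‖ ^ 2`)
  and the square is convex (`norm_noisy_step_sq_le`);
* `f x_k - f_*`, with `q = 1 - gdGap μ L α`, by the descent lemma, a weighted Young inequality
  for the cross term of gradient and noise, and the Polyak–Łojasiewicz inequality
  (`noisy_step_sub_le`).

Unrolling and summing such a recursion (`sum_le_of_linear_recursion`) dominates `S_K` by a
constant plus a weighted sum `∑ β_j * ‖w_j‖ ^ 2`. The weights are deterministic, so the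
exponential moment of that sum is at most a product over `j`: conditionally on the past,
integrating the tail bound gives `E exp (l * ‖w_j‖ ^ 2) ≤ (1 + 2σ²l) / (1 - 2σ²l)`
(`lintegral_mul_exp_le`), whatever the bias of the noise. Taking logarithms yields the two risk bounds.

The weights are at most `L / 2 * (b / (1 - q))` for the first recursion, where the factor `L / 2`
converts squared distances to suboptimality, and at most `b / (1 - q)` for the second. The latter
limit equals `gdHbar ^ 2` when `α ≤ 2 / (L + √(L * μ))`, and the former does otherwise
(`gdHbar_sq_of_le`, `gdHbar_sq_of_lt`), so at least one of the two bounds is finite when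
`θ * gdHbar ^ 2 < 1`.
-/

open scoped RealInnerProductSpace

/-! ### Smooth and strongly convex functions -/

section Deterministic

variable {E : Type*} [NormedAddCommGroup E] [InnerProductSpace ℝ E]

/-- The half of the Baillon–Haddad theorem needed here: if the Bregman divergence of `G` (with
gradient field `v`) lies between `0` and `M / 2 * ‖y - x‖ ^ 2`, then `v` is `1 / M`-cocoercive. -/
lemma norm_sub_sq_le_mul_inner_of_bregman {G : E → ℝ} {v : E → E} {M : ℝ} (hM : 0 < M)
    (hlow : ∀ x y, 0 ≤ G y - G x - ⟪v x, y - x⟫)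
    (hup : ∀ x y, G y - G x - ⟪v x, y - x⟫ ≤ M / 2 * ‖y - x‖ ^ 2) (x y : E) :
    ‖v y - v x‖ ^ 2 ≤ M * ⟪v y - v x, y - x⟫ := by
  -- The divergence from `x` is nonnegative at `y - (1 / M) • (v y - v x)`, the minimizer of its
  -- quadratic upper model around `y`.
  have key : ∀ x y, ‖v y - v x‖ ^ 2 / (2 * M) ≤ G y - G x - ⟪v x, y - x⟫ := by
    intro x y
    have h1 := hlow x (y - (1 / M) • (v y - v x))
    have h2 := hup y (y - (1 / M) • (v y - v x))
    have e1 : y - (1 / M) • (v y - v x) - x = (y - x) - (1 / M) • (v y - v x) := by abel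
    have e2 : y - (1 / M) • (v y - v x) - y = -((1 / M) • (v y - v x)) := by abel
    rw [e1, inner_sub_right, inner_smul_right] at h1
    rw [e2, inner_neg_right, inner_smul_right, norm_neg, norm_smul, mul_pow, Real.norm_eq_abs,
      sq_abs] at h2
    have h3 : ⟪v y, v y - v x⟫ - ⟪v x, v y - v x⟫ = ‖v y - v x‖ ^ 2 := by
      rw [← inner_sub_left, real_inner_self_eq_norm_sq]
    have h4 : M / 2 * ((1 / M) ^ 2 * ‖v y - v x‖ ^ 2) = ‖v y - v x‖ ^ 2 / (2 * M) := by
      field_simp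
    have h5 : 1 / M * (⟪v y, v y - v x⟫ - ⟪v x, v y - v x⟫) = 2 * (‖v y - v x‖ ^ 2 / (2 * M)) := by
      rw [h3]; field_simp
    linarith
  have h1 := key x y
  have h2 := key y x
  have e : ⟪v y, x - y⟫ = -⟪v y, y - x⟫ := by rw [← inner_neg_right, neg_sub]
  rw [e, norm_sub_rev (v x)] at h2
  rw [inner_sub_left]
  have h3 : 2 * (‖v y - v x‖ ^ 2 / (2 * M)) ≤ ⟪v y, y - x⟫ - ⟪v x, y - x⟫ := by linarith
  rw [show 2 * (‖v y - v x‖ ^ 2 / (2 * M)) = ‖v y - v x‖ ^ 2 / M by field_simp,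
    div_le_iff₀ hM] at h3
  linarith

/-- The derivative of a differentiable function along a line. -/
lemma hasDerivAt_comp_line [CompleteSpace E] {f : E → ℝ} (hf : Differentiable ℝ f) (x v : E)
    (t : ℝ) : HasDerivAt (fun t : ℝ => f (x + t • v)) ⟪gradient f (x + t • v), v⟫ t := by
  have h1 := (hf (x + t • v)).hasGradientAt.hasFDerivAt
  have h2 : HasDerivAt (fun t : ℝ => x + t • v) v t := by
    simpa using ((hasDerivAt_id t).smul_const v).const_add x
  exact h1.comp_hasDerivAt t h2

/-- The descent lemma. -/
lemma le_add_of_lipschitz_gradient [CompleteSpace E] {f : E → ℝ} {L : ℝ}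
    (hf : Differentiable ℝ f)
    (hL : ∀ x y, ‖gradient f x - gradient f y‖ ≤ L * ‖x - y‖) (x y : E) :
    f y ≤ f x + ⟪gradient f x, y - x⟫ + L / 2 * ‖y - x‖ ^ 2 := by
  obtain ⟨v, rfl⟩ : ∃ v, y = x + v := ⟨y - x, by abel⟩
  rw [add_sub_cancel_left]
  have hd : ∀ t : ℝ, HasDerivAt
      (fun t : ℝ => f (x + t • v) - t * ⟪gradient f x, v⟫ - L / 2 * ‖v‖ ^ 2 * t ^ 2)
      (⟪gradient f (x + t • v), v⟫ - ⟪gradient f x, v⟫ - L / 2 * ‖v‖ ^ 2 * (2 * t)) t := by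
    intro t
    have h2 := (hasDerivAt_id t).mul_const ⟪gradient f x, v⟫
    have h3 := (hasDerivAt_pow 2 t).const_mul (L / 2 * ‖v‖ ^ 2)
    exact (((hasDerivAt_comp_line hf x v t).sub h2).sub h3).congr_deriv (by norm_num)
  have hanti := antitoneOn_of_deriv_nonpos (convex_Icc (0 : ℝ) 1)
    (fun t _ => (hd t).continuousAt.continuousWithinAt)
    (fun t _ => (hd t).differentiableAt.differentiableWithinAt) (by
      intro t ht
      rw [interior_Icc] at ht
      rw [(hd t).deriv, ← inner_sub_left]
      have h1 := real_inner_le_norm (gradient f (x + t • v) - gradient f x) v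
      have h2 := hL (x + t • v) x
      rw [add_sub_cancel_left, norm_smul, Real.norm_eq_abs, abs_of_pos ht.1] at h2
      have h3 := mul_le_mul_of_nonneg_right h2 (norm_nonneg v)
      nlinarith)
  have := hanti (Set.left_mem_Icc.2 zero_le_one) (Set.right_mem_Icc.2 zero_le_one) zero_le_one
  simp only [one_smul, zero_smul, add_zero] at this
  linarith

/-- The first-order lower bound of a strongly convex function. -/
lemma add_le_of_strongConvex [CompleteSpace E] {f : E → ℝ} {μ : ℝ} (hf : Differentiable ℝ f)
    (hc : ConvexOn ℝ Set.univ (fun x => f x - 1 / 2 * μ * ‖x‖ ^ 2)) (x y : E) :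
    f x + ⟪gradient f x, y - x⟫ + μ / 2 * ‖y - x‖ ^ 2 ≤ f y := by
  obtain ⟨v, rfl⟩ : ∃ v, y = x + v := ⟨y - x, by abel⟩
  rw [add_sub_cancel_left]
  have hline : ConvexOn ℝ Set.univ
      (fun t : ℝ => f (x + t • v) - 1 / 2 * μ * ‖x + t • v‖ ^ 2) := by
    have := hc.comp_affineMap (AffineMap.lineMap x (x + v) : ℝ →ᵃ[ℝ] E)
    simpa [Function.comp_def, AffineMap.lineMap_apply, add_comm] using this
  have hexp : ∀ t : ℝ, ‖x + t • v‖ ^ 2 = ‖x‖ ^ 2 + 2 * t * ⟪x, v⟫ + t ^ 2 * ‖v‖ ^ 2 := by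
    intro t
    rw [norm_add_sq_real, inner_smul_right, norm_smul, mul_pow, Real.norm_eq_abs, sq_abs]
    ring
  have hd : HasDerivAt (fun t : ℝ => f (x + t • v) - 1 / 2 * μ * ‖x + t • v‖ ^ 2)
      (⟪gradient f x, v⟫ - μ * ⟪x, v⟫) 0 := by
    have h1 := hasDerivAt_comp_line hf x v 0
    rw [zero_smul, add_zero] at h1
    have h2 : HasDerivAt (fun t : ℝ => 1 / 2 * μ * ‖x + t • v‖ ^ 2) (μ * ⟪x, v⟫) 0 := by
      simp_rw [hexp]
      have h3 := (((hasDerivAt_id (0 : ℝ)).const_mul 2).mul_const ⟪x, v⟫).const_add (‖x‖ ^ 2)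
      have h4 := ((h3.add ((hasDerivAt_pow 2 (0 : ℝ)).mul_const (‖v‖ ^ 2)))).const_mul (1 / 2 * μ)
      exact h4.congr_deriv (by norm_num; ring)
    exact h1.sub h2
  have := hline.le_slope_of_hasDerivAt (Set.mem_univ 0) (Set.mem_univ 1) zero_lt_one hd
  rw [slope_def_field] at this
  have h1 := hexp 1
  simp only [one_smul, zero_smul, add_zero, sub_zero, div_one, one_pow] at this h1
  rw [h1] at this
  nlinarith

/-- The contraction estimate for a noiseless gradient step: `e` is the distance vector to the
minimizer, and the gradient is `μ • e + Δ`, where `Δ` is the cocoercive part left after removing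
the strongly convex quadratic. -/
lemma norm_sub_smul_le_of_cocoercive {e Δ : E} {μ L α : ℝ}
    (hα : 0 < α) (hμL : μ < L) (hco : ‖Δ‖ ^ 2 ≤ (L - μ) * ⟪Δ, e⟫) :
    ‖e - α • (μ • e + Δ)‖ ≤ max |1 - α * μ| |1 - α * L| * ‖e‖ := by
  have hM : 0 < L - μ := sub_pos.2 hμL
  have hin : ⟪Δ, e⟫ ≤ (L - μ) * ‖e‖ ^ 2 := by
    have h1 := real_inner_le_norm Δ e
    have h2 : ‖Δ‖ ≤ (L - μ) * ‖e‖ := by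
      by_contra! h
      have h3 : 0 < ‖Δ‖ := lt_of_le_of_lt (by positivity) h
      nlinarith [mul_le_mul_of_nonneg_left h1 hM.le]
    nlinarith [norm_nonneg e]
  have hin0 : 0 ≤ ⟪Δ, e⟫ := by
    by_contra! h
    nlinarith [sq_nonneg ‖Δ‖]
  have hexp : ‖e - α • (μ • e + Δ)‖ ^ 2
      = (1 - α * μ) ^ 2 * ‖e‖ ^ 2 - 2 * α * (1 - α * μ) * ⟪Δ, e⟫ + α ^ 2 * ‖Δ‖ ^ 2 := by
    rw [show e - α • (μ • e + Δ) = (1 - α * μ) • e - α • Δ by module, norm_sub_sq_real,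
      norm_smul, norm_smul, inner_smul_left, inner_smul_right, real_inner_comm, mul_pow, mul_pow]
    simp only [Real.norm_eq_abs, sq_abs, conj_trivial]
    ring
  have h1 : α ^ 2 * ‖Δ‖ ^ 2 ≤ α ^ 2 * ((L - μ) * ⟪Δ, e⟫) := by gcongr
  refine le_of_sq_le_sq ?_ (by positivity)
  rw [mul_pow, hexp]
  -- The bound is affine in `⟪Δ, e⟫ ∈ [0, (L - μ) * ‖e‖ ^ 2]`, hence maximal at an end point.
  rcases le_total (α * (L - μ)) (2 * (1 - α * μ)) with h | h
  · have h2 : (1 - α * μ) ^ 2 ≤ max |1 - α * μ| |1 - α * L| ^ 2 := by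
      rw [← sq_abs (1 - α * μ)]; gcongr; exact le_max_left _ _
    nlinarith [mul_le_mul_of_nonneg_right h2 (sq_nonneg ‖e‖),
      mul_nonneg (mul_nonneg hα.le (sub_nonneg.2 h)) hin0]
  · have h2 : (1 - α * L) ^ 2 ≤ max |1 - α * μ| |1 - α * L| ^ 2 := by
      rw [← sq_abs (1 - α * L)]; gcongr; exact le_max_right _ _
    nlinarith [mul_le_mul_of_nonneg_right h2 (sq_nonneg ‖e‖),
      mul_nonneg (mul_nonneg hα.le (sub_nonneg.2 h)) (sub_nonneg.2 hin)]

end Deterministic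

namespace IsStronglyConvexSmooth

variable {d : ℕ} {μ L : ℝ} {f : EuclideanSpace ℝ (Fin d) → ℝ}

lemma differentiable (hf : IsStronglyConvexSmooth μ L f) : Differentiable ℝ f :=
  hf.contDiff.differentiable (by norm_num)

lemma gradient_eq_zero_of_isMinOn {xstar : EuclideanSpace ℝ (Fin d)}
    (hx : IsMinOn f Set.univ xstar) : gradient f xstar = 0 := by
  have h : IsLocalMin f xstar := hx.isLocalMin Filter.univ_mem
  rw [gradient, h.fderiv_eq_zero, map_zero]

lemma continuous_gradient (hf : IsStronglyConvexSmooth μ L f) : Continuous (gradient f) :=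
  (LipschitzWith.of_dist_le' (K := L) fun x y => by
    simpa [dist_eq_norm] using hf.lipschitz_gradient x y).continuous

/-- The Polyak–Łojasiewicz inequality. -/
lemma two_mul_sub_le_norm_gradient_sq (hf : IsStronglyConvexSmooth μ L f) (hμ : 0 < μ)
    (x y : EuclideanSpace ℝ (Fin d)) : 2 * μ * (f x - f y) ≤ ‖gradient f x‖ ^ 2 := by
  have h1 := add_le_of_strongConvex hf.differentiable hf.strongConvex x y
  have h2 := abs_real_inner_le_norm (gradient f x) (y - x)
  have h3 := neg_abs_le ⟪gradient f x, y - x⟫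
  nlinarith [sq_nonneg (‖gradient f x‖ - μ * ‖y - x‖)]

lemma sub_le_norm_sq (hf : IsStronglyConvexSmooth μ L f) {xstar : EuclideanSpace ℝ (Fin d)}
    (hx : IsMinOn f Set.univ xstar) (x : EuclideanSpace ℝ (Fin d)) :
    f x - f xstar ≤ L / 2 * ‖x - xstar‖ ^ 2 := by
  have h := le_add_of_lipschitz_gradient hf.differentiable hf.lipschitz_gradient xstar x
  rw [gradient_eq_zero_of_isMinOn hx, inner_zero_left] at h
  linarith

/-- A noiseless gradient step contracts the distance to the minimizer by the factor `gdRho`. -/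
lemma norm_gradient_step_le (hf : IsStronglyConvexSmooth μ L f) (hμL : μ < L) {α : ℝ}
    (hα : 0 < α) {xstar : EuclideanSpace ℝ (Fin d)} (hx : IsMinOn f Set.univ xstar)
    (x : EuclideanSpace ℝ (Fin d)) :
    ‖x - α • gradient f x - xstar‖ ≤ gdRho μ L α * ‖x - xstar‖ := by
  have hco := norm_sub_sq_le_mul_inner_of_bregman (G := fun x => f x - μ / 2 * ‖x‖ ^ 2)
    (v := fun x => gradient f x - μ • x) (sub_pos.2 hμL)
    (fun x y => by
      have h1 := add_le_of_strongConvex hf.differentiable hf.strongConvex x y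
      have h2 : ‖y‖ ^ 2 = ‖x‖ ^ 2 + 2 * ⟪x, y - x⟫ + ‖y - x‖ ^ 2 := by
        rw [← norm_add_sq_real, add_sub_cancel]
      rw [inner_sub_left, inner_smul_left, conj_trivial]
      linear_combination h1 + μ / 2 * h2)
    (fun x y => by
      have h1 := le_add_of_lipschitz_gradient hf.differentiable hf.lipschitz_gradient x y
      have h2 : ‖y‖ ^ 2 = ‖x‖ ^ 2 + 2 * ⟪x, y - x⟫ + ‖y - x‖ ^ 2 := by
        rw [← norm_add_sq_real, add_sub_cancel]
      rw [inner_sub_left, inner_smul_left, conj_trivial]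
      linear_combination h1 - μ / 2 * h2)
    xstar x
  have h := norm_sub_smul_le_of_cocoercive (e := x - xstar) hα hμL hco
  rw [gradient_eq_zero_of_isMinOn hx] at h
  rwa [show x - xstar - α • (μ • (x - xstar) + (gradient f x - μ • x - (0 - μ • xstar)))
    = x - α • gradient f x - xstar by module] at h

/-- One noisy gradient step, measured by the squared distance to the minimizer. -/
lemma norm_noisy_step_sq_le (hf : IsStronglyConvexSmooth μ L f) (hμL : μ < L) {α : ℝ}
    (hα : 0 < α) (hρ0 : 0 ≤ gdRho μ L α) (hρ : gdRho μ L α < 1)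
    {xstar : EuclideanSpace ℝ (Fin d)} (hx : IsMinOn f Set.univ xstar)
    (x w : EuclideanSpace ℝ (Fin d)) :
    ‖x - α • (gradient f x + w) - xstar‖ ^ 2
      ≤ gdRho μ L α * ‖x - xstar‖ ^ 2 + α ^ 2 / (1 - gdRho μ L α) * ‖w‖ ^ 2 := by
  have h1 : ‖x - α • (gradient f x + w) - xstar‖ ≤ gdRho μ L α * ‖x - xstar‖ + α * ‖w‖ := by
    calc ‖x - α • (gradient f x + w) - xstar‖
        = ‖(x - α • gradient f x - xstar) - α • w‖ := by congr 1; module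
      _ ≤ ‖x - α • gradient f x - xstar‖ + ‖α • w‖ := norm_sub_le _ _
      _ ≤ _ := by
        rw [norm_smul, Real.norm_eq_abs, abs_of_pos hα]
        gcongr
        exact hf.norm_gradient_step_le hμL hα hx x
  refine (pow_le_pow_left₀ (norm_nonneg _) h1 2).trans ?_
  -- Convexity of the square, with weights `gdRho` and `1 - gdRho`.
  generalize gdRho μ L α = ρ at *
  have h2 : 0 < 1 - ρ := by linarith
  have h3 : ρ * ‖x - xstar‖ ^ 2 + α ^ 2 / (1 - ρ) * ‖w‖ ^ 2 - (ρ * ‖x - xstar‖ + α * ‖w‖) ^ 2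
      = ρ / (1 - ρ) * ((1 - ρ) * ‖x - xstar‖ - α * ‖w‖) ^ 2 := by
    field_simp; ring
  have h4 : 0 ≤ ρ / (1 - ρ) * ((1 - ρ) * ‖x - xstar‖ - α * ‖w‖) ^ 2 := by positivity
  linarith

/-- One noisy gradient step, measured by the suboptimality. The parameter `s` weighs the two
parts of the cross term between the gradient and the noise. -/
lemma noisy_step_sub_le (hf : IsStronglyConvexSmooth μ L f) (hμ : 0 < μ) {α s : ℝ}
    (hα : 0 < α) (hs : 0 < s) (hcoef : 0 ≤ α * (1 - L * α / 2) - α * |1 - α * L| * s / 2)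
    (x w y : EuclideanSpace ℝ (Fin d)) :
    f (x - α • (gradient f x + w)) - f y
      ≤ (1 - (2 * μ * α * (1 - L * α / 2) - α * μ * |1 - α * L| * s)) * (f x - f y)
        + α * (L / 2 * α + |1 - α * L| / (2 * s)) * ‖w‖ ^ 2 := by
  have h1 := le_add_of_lipschitz_gradient hf.differentiable hf.lipschitz_gradient x
    (x - α • (gradient f x + w))
  rw [show x - α • (gradient f x + w) - x = -(α • (gradient f x + w)) by abel, norm_neg,
    inner_neg_right, norm_smul, inner_smul_right, inner_add_right, real_inner_self_eq_norm_sq,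
    mul_pow, norm_add_sq_real, Real.norm_eq_abs, sq_abs] at h1
  have h2 := hf.two_mul_sub_le_norm_gradient_sq hμ x y
  have h3 : -((1 - α * L) * ⟪gradient f x, w⟫)
      ≤ |1 - α * L| * (s / 2 * ‖gradient f x‖ ^ 2 + 1 / (2 * s) * ‖w‖ ^ 2) := by
    calc -((1 - α * L) * ⟪gradient f x, w⟫) ≤ |(1 - α * L) * ⟪gradient f x, w⟫| := neg_le_abs _
      _ = |1 - α * L| * |⟪gradient f x, w⟫| := abs_mul _ _
      _ ≤ _ := by
        gcongr
        refine (abs_real_inner_le_norm _ _).trans ?_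
        have h4 : s / 2 * ‖gradient f x‖ ^ 2 + 1 / (2 * s) * ‖w‖ ^ 2 - ‖gradient f x‖ * ‖w‖
            = (s * ‖gradient f x‖ - ‖w‖) ^ 2 / (2 * s) := by field_simp; ring
        have h5 : 0 ≤ (s * ‖gradient f x‖ - ‖w‖) ^ 2 / (2 * s) := by positivity
        linarith
  have h4 := mul_le_mul_of_nonneg_left h3 hα.le
  have h5 := mul_le_mul_of_nonneg_left h2 hcoef
  have h6 : α * (L / 2 * α + |1 - α * L| / (2 * s)) * ‖w‖ ^ 2
      = L / 2 * α ^ 2 * ‖w‖ ^ 2 + α * (|1 - α * L| * (1 / (2 * s) * ‖w‖ ^ 2)) := by ring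
  rw [h6]
  linear_combination h1 + h4 + h5

end IsStronglyConvexSmooth

/-! ### Linear recursions -/

/-- Unrolling the recursion `V (k + 1) ≤ q * V k + b * W (k + 1)` and summing over `k`. -/
lemma sum_le_of_linear_recursion {V W : ℕ → ℝ} {q b : ℝ} (hq0 : 0 ≤ q) (hq1 : q < 1)
    (h : ∀ k, V (k + 1) ≤ q * V k + b * W (k + 1)) (K : ℕ) :
    ∑ k ∈ Finset.range (K + 1), V k ≤ (1 - q ^ (K + 1)) / (1 - q) * V 0
      + ∑ j ∈ Finset.Icc 1 K, (1 - q ^ (K - j + 1)) / (1 - q) * b * W j := by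
  have hq : 0 < 1 - q := sub_pos.2 hq1
  induction K generalizing V W with
  | zero => simp [hq.ne']
  | succ K ih =>
    -- The sequence shifted by one obeys the same recursion, started from `V 1 ≤ q * V 0 + b * W 1`.
    have h1 := ih (V := fun k => V (k + 1)) (W := fun k => W (k + 1)) fun k => h (k + 1)
    have h2 : 0 ≤ (1 - q ^ (K + 1)) / (1 - q) :=
      div_nonneg (sub_nonneg.2 (pow_le_one₀ hq0 hq1.le)) hq.le
    have h3 := mul_le_mul_of_nonneg_left (h 0) h2
    rw [Finset.sum_range_succ', ← Finset.add_sum_Ioc_eq_sum_Icc (by lia : 1 ≤ K + 1)]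
    have h4 : ∑ j ∈ Finset.Ioc 1 (K + 1), (1 - q ^ (K + 1 - j + 1)) / (1 - q) * b * W j
        = ∑ j ∈ Finset.Icc 1 K, (1 - q ^ (K - j + 1)) / (1 - q) * b * W (j + 1) := by
      rw [show Finset.Ioc 1 (K + 1) = (Finset.Icc 1 K).image (· + 1) by
        rw [Finset.image_add_right_Icc]; ext; simp; lia, Finset.sum_image (by simp)]
      simp
    rw [h4]
    have h5 : (1 - q ^ (K + 1 + 1)) / (1 - q) = 1 + q * ((1 - q ^ (K + 1)) / (1 - q)) := by
      field_simp; ring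
    rw [h5]
    simp only [Nat.add_sub_cancel, zero_add] at h3 h1 ⊢
    linarith

/-! ### Exponential moments of light-tailed noise -/

section Probability

open scoped ENNReal

variable {Ω : Type*}

/-- A measure under which `X ≥ 0` has the sub-exponential tail `2 * exp (-t / (2 * σ ^ 2))` gives
`exp (l * X)` at most `(1 + 2σ²l) / (1 - 2σ²l)` times its total mass. -/
lemma lintegral_exp_mul_le_of_tail [MeasurableSpace Ω] {ν : Measure Ω} {X : Ω → ℝ} {σ l : ℝ}
    (hσ : 0 < σ) (hX : Measurable X) (hX0 : 0 ≤ X) (hl0 : 0 ≤ l) (hl1 : 2 * σ ^ 2 * l < 1)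
    (htail : ∀ t : ℝ, 0 ≤ t → ν {ω | t ≤ X ω}
      ≤ ENNReal.ofReal (2 * Real.exp (-t / (2 * σ ^ 2))) * ν Set.univ) :
    ∫⁻ ω, ENNReal.ofReal (Real.exp (l * X ω)) ∂ν
      ≤ ENNReal.ofReal ((1 + 2 * σ ^ 2 * l) / (1 - 2 * σ ^ 2 * l)) * ν Set.univ := by
  have hprim : ∀ v : ℝ, ∫ t in 0..v, l * Real.exp (l * t) = Real.exp (l * v) - 1 := by
    intro v
    simp
  have hcake := lintegral_comp_eq_lintegral_meas_le_mul ν (f := X)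
    (g := fun t => l * Real.exp (l * t)) (Filter.Eventually.of_forall hX0) hX.aemeasurable
    (fun t _ => by apply Continuous.intervalIntegrable; fun_prop)
    (Filter.Eventually.of_forall fun t => by positivity)
  simp_rw [hprim] at hcake
  -- The rate at which the tail beats the exponential.
  have hr : 0 < 1 / (2 * σ ^ 2) - l := by
    rw [sub_pos, lt_div_iff₀ (by positivity)]; linarith
  have hint : ∫⁻ t in Set.Ioi (0 : ℝ),
      ENNReal.ofReal (2 * l * Real.exp (-(1 / (2 * σ ^ 2) - l) * t))
      = ENNReal.ofReal (2 * l / (1 / (2 * σ ^ 2) - l)) := by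
    rw [← ofReal_integral_eq_lintegral_ofReal
      ((integrableOn_exp_mul_Ioi (neg_lt_zero.2 hr) 0).const_mul _)
      (Filter.Eventually.of_forall fun t => by positivity), integral_const_mul,
      integral_exp_mul_Ioi (neg_lt_zero.2 hr)]
    congr 1
    rw [mul_zero, Real.exp_zero, neg_div_neg_eq]
    ring
  have hsecond : ∫⁻ ω, ENNReal.ofReal (Real.exp (l * X ω) - 1) ∂ν
      ≤ ENNReal.ofReal (2 * l / (1 / (2 * σ ^ 2) - l)) * ν Set.univ := by
    rw [hcake, ← hint, ← lintegral_mul_const _ (by fun_prop)]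
    refine setLIntegral_mono (by fun_prop) fun t ht => ?_
    refine (mul_le_mul_left (htail t (Set.mem_Ioi.1 ht).le) _).trans (le_of_eq ?_)
    rw [mul_right_comm, ← ENNReal.ofReal_mul (by positivity)]
    congr 2
    rw [show -(1 / (2 * σ ^ 2) - l) * t = -t / (2 * σ ^ 2) + l * t by ring, Real.exp_add]
    ring
  calc ∫⁻ ω, ENNReal.ofReal (Real.exp (l * X ω)) ∂ν
      = ∫⁻ ω, (1 + ENNReal.ofReal (Real.exp (l * X ω) - 1)) ∂ν := by
        congr with ω
        rw [← ENNReal.ofReal_one, ← ENNReal.ofReal_add zero_le_one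
          (sub_nonneg.2 (Real.one_le_exp (mul_nonneg hl0 (hX0 ω)))), add_sub_cancel]
    _ = ν Set.univ + ∫⁻ ω, ENNReal.ofReal (Real.exp (l * X ω) - 1) ∂ν := by
        rw [lintegral_add_left measurable_const, lintegral_const, one_mul]
    _ ≤ ν Set.univ + ENNReal.ofReal (2 * l / (1 / (2 * σ ^ 2) - l)) * ν Set.univ := by gcongr
    _ = _ := by
        rw [← one_add_mul, ← ENNReal.ofReal_one, ← ENNReal.ofReal_add zero_le_one (by positivity)]
        congr 2
        have h1 : 1 - 2 * σ ^ 2 * l ≠ 0 := by linarith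
        rw [show 1 / (2 * σ ^ 2) - l = (1 - 2 * σ ^ 2 * l) / (2 * σ ^ 2) by field_simp,
          div_div_eq_mul_div, eq_div_iff h1, add_mul, div_mul_cancel₀ _ h1]
        ring

/-- A bound on a conditional probability also bounds integrals of nonnegative functions
measurable with respect to the conditioning σ-algebra. -/
lemma setLIntegral_le_of_condExp_indicator_le {m m0 : MeasurableSpace Ω} (hm : m ≤ m0)
    {P : Measure Ω} [IsProbabilityMeasure P] {A : Set Ω} (hA : MeasurableSet A) {c : ℝ}
    (hc : 0 ≤ c) (h : P⟦A | m⟧ ≤ᵐ[P] fun _ => c) {Z : Ω → ℝ≥0∞} (hZ : Measurable[m] Z) :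
    ∫⁻ ω in A, Z ω ∂P ≤ ENNReal.ofReal c * ∫⁻ ω, Z ω ∂P := by
  have hle : (P.restrict A).trim hm ≤ ENNReal.ofReal c • P.trim hm := by
    refine Measure.le_iff.2 fun s hs => ?_
    rw [trim_measurableSet_eq hm hs, Measure.smul_apply, trim_measurableSet_eq hm hs,
      Measure.restrict_apply (hm s hs), smul_eq_mul]
    have h1 : ∫ ω in s, (P⟦A | m⟧) ω ∂P = P.real (s ∩ A) := by
      rw [setIntegral_condExp hm ((integrable_const 1).indicator hA) hs,
        setIntegral_indicator hA]
      simp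
    have h2 : ∫ ω in s, (P⟦A | m⟧) ω ∂P ≤ ∫ ω in s, c ∂P :=
      setIntegral_mono_ae integrable_condExp.integrableOn (integrable_const c).integrableOn h
    rw [h1, setIntegral_const, smul_eq_mul] at h2
    rw [← ofReal_measureReal, ← ofReal_measureReal (s := s), ← ENNReal.ofReal_mul hc]
    exact ENNReal.ofReal_le_ofReal (by linarith)
  calc ∫⁻ ω in A, Z ω ∂P = ∫⁻ ω, Z ω ∂((P.restrict A).trim hm) := (lintegral_trim hm hZ).symm
    _ ≤ ∫⁻ ω, Z ω ∂(ENNReal.ofReal c • P.trim hm) := lintegral_mono' hle le_rfl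
    _ = _ := by rw [lintegral_smul_measure, lintegral_trim hm hZ, smul_eq_mul]

lemma iterSigma_mono {d : ℕ} (x : ℕ → Ω → EuclideanSpace ℝ (Fin d)) : Monotone (iterSigma x) :=
  fun _ _ hjk => iSup₂_le fun i hi =>
    le_iSup₂ (f := fun j _ => MeasurableSpace.comap (x j) inferInstance) i (hi.trans hjk)

lemma iterSigma_le [m0 : MeasurableSpace Ω] {d : ℕ} {x : ℕ → Ω → EuclideanSpace ℝ (Fin d)}
    (hx : ∀ k, Measurable (x k)) (k : ℕ) : iterSigma x k ≤ m0 :=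
  iSup₂_le fun j _ => (hx j).comap_le

namespace IsSubGaussianNoise

variable [MeasurableSpace Ω] {P : Measure Ω} [IsProbabilityMeasure P] {d : ℕ}
  {x w : ℕ → Ω → EuclideanSpace ℝ (Fin d)} {σ : ℝ}

/-- Conditionally on the past, the squared noise has exponential moments at most
`(1 + 2σ²l) / (1 - 2σ²l)`; the past enters through the weight `Z`. -/
lemma lintegral_mul_exp_le (hw : IsSubGaussianNoise P x w σ) (hx : ∀ k, Measurable (x k))
    (hσ : 0 < σ) {l : ℝ} (hl0 : 0 ≤ l) (hl1 : 2 * σ ^ 2 * l < 1) (k : ℕ) {Z : Ω → ℝ≥0∞}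
    (hZ : Measurable[iterSigma x k] Z) :
    ∫⁻ ω, Z ω * ENNReal.ofReal (Real.exp (l * ‖w (k + 1) ω‖ ^ 2)) ∂P
      ≤ ENNReal.ofReal ((1 + 2 * σ ^ 2 * l) / (1 - 2 * σ ^ 2 * l)) * ∫⁻ ω, Z ω ∂P := by
  have hm := iterSigma_le hx k
  have hwm := hw.measurable k
  have hZ' : Measurable Z := hZ.mono hm le_rfl
  have h := lintegral_exp_mul_le_of_tail (ν := P.withDensity Z)
    (X := fun ω => ‖w (k + 1) ω‖ ^ 2) hσ (by fun_prop) (fun ω => by positivity) hl0 hl1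
    (fun t ht => by
      have hset : {ω | t ≤ ‖w (k + 1) ω‖ ^ 2} = {ω | √t ≤ ‖w (k + 1) ω‖} := by
        ext ω; exact (Real.sqrt_le_left (norm_nonneg _)).symm
      have hms : MeasurableSet {ω | √t ≤ ‖w (k + 1) ω‖} :=
        measurableSet_le measurable_const hwm.norm
      have htail := hw.tail k (√t) (Real.sqrt_nonneg t)
      rw [Real.sq_sqrt ht] at htail
      rw [hset, withDensity_apply _ hms, withDensity_apply _ MeasurableSet.univ,
        Measure.restrict_univ]
      exact setLIntegral_le_of_condExp_indicator_le hm hms (by positivity) htail hZ)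
  rwa [lintegral_withDensity_eq_lintegral_mul _ hZ' (by fun_prop),
    withDensity_apply _ MeasurableSet.univ, Measure.restrict_univ] at h

lemma lintegral_prod_exp_le (hw : IsSubGaussianNoise P x w σ) (hx : ∀ k, Measurable (x k))
    (hσ : 0 < σ) {l : ℕ → ℝ} (K : ℕ) (hl0 : ∀ j ∈ Finset.Icc 1 K, 0 ≤ l j)
    (hl1 : ∀ j ∈ Finset.Icc 1 K, 2 * σ ^ 2 * l j < 1) :
    ∫⁻ ω, ∏ j ∈ Finset.Icc 1 K, ENNReal.ofReal (Real.exp (l j * ‖w j ω‖ ^ 2)) ∂P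
      ≤ ∏ j ∈ Finset.Icc 1 K,
        ENNReal.ofReal ((1 + 2 * σ ^ 2 * l j) / (1 - 2 * σ ^ 2 * l j)) := by
  induction K with
  | zero => simp
  | succ K ih =>
    have hsub : Finset.Icc 1 K ⊆ Finset.Icc 1 (K + 1) := Finset.Icc_subset_Icc_right K.le_succ
    have hmem : K + 1 ∈ Finset.Icc 1 (K + 1) := by simp
    simp_rw [Finset.prod_Icc_succ_top (by lia : 1 ≤ K + 1)]
    have hZ : Measurable[iterSigma x K] fun ω =>
        ∏ j ∈ Finset.Icc 1 K, ENNReal.ofReal (Real.exp (l j * ‖w j ω‖ ^ 2)) := by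
      refine Finset.measurable_fun_prod _ fun j hj => ?_
      obtain ⟨i, rfl⟩ : ∃ i, j = i + 1 := ⟨j - 1, by have := Finset.mem_Icc.1 hj; lia⟩
      have h1 : Measurable[iterSigma x K] (w (i + 1)) :=
        (hw.adapted i).mono (iterSigma_mono x (Finset.mem_Icc.1 hj).2) le_rfl
      fun_prop
    refine (hw.lintegral_mul_exp_le hx hσ (hl0 _ hmem) (hl1 _ hmem) K hZ).trans ?_
    rw [mul_comm]
    gcongr
    exact ih (fun j hj => hl0 j (hsub hj)) fun j hj => hl1 j (hsub hj)

/-- A cumulative cost dominated by a constant plus a weighted sum of squared noise norms has a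
finite risk-sensitive cost, bounded through the exponential moments of the noise. -/
lemma integrable_and_riskCost_le (hw : IsSubGaussianNoise P x w σ) (hx : ∀ k, Measurable (x k))
    (hσ : 0 < σ) {θ : ℝ} (hθ : 0 < θ) {S : Ω → ℝ} (hS : Measurable S) {K : ℕ} {β : ℕ → ℝ} {A : ℝ}
    (hβ0 : ∀ j ∈ Finset.Icc 1 K, 0 ≤ β j) (hβ1 : ∀ j ∈ Finset.Icc 1 K, 0 < 1 - θ * β j)
    (hSle : ∀ ω, S ω ≤ A + ∑ j ∈ Finset.Icc 1 K, β j * ‖w j ω‖ ^ 2) :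
    Integrable (fun ω => Real.exp (θ / (2 * σ ^ 2) * S ω)) P ∧
      riskCost P S σ θ K ≤ 1 / (K + 1) * (A + 2 * σ ^ 2 / θ *
        ∑ j ∈ Finset.Icc 1 K, Real.log ((1 + θ * β j) / (1 - θ * β j))) := by
  set c := θ / (2 * σ ^ 2) with hc
  have hc0 : 0 < c := by positivity
  have hl : ∀ j, 2 * σ ^ 2 * (c * β j) = θ * β j := fun j => by rw [hc]; field_simp
  have hpos : ∀ j ∈ Finset.Icc 1 K, 0 < (1 + θ * β j) / (1 - θ * β j) := fun j hj =>
    div_pos (by linarith [mul_nonneg hθ.le (hβ0 j hj)]) (hβ1 j hj)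
  set B := Real.exp (c * A) * ∏ j ∈ Finset.Icc 1 K, (1 + θ * β j) / (1 - θ * β j) with hB
  have hprod := hw.lintegral_prod_exp_le hx hσ (l := fun j => c * β j) K
    (fun j hj => mul_nonneg hc0.le (hβ0 j hj))
    (fun j hj => by rw [hl]; linarith [hβ1 j hj])
  simp_rw [hl] at hprod
  rw [← ENNReal.ofReal_prod_of_nonneg fun j hj => (hpos j hj).le] at hprod
  have hbound : ∫⁻ ω, ENNReal.ofReal (Real.exp (c * S ω)) ∂P ≤ ENNReal.ofReal B := by
    calc ∫⁻ ω, ENNReal.ofReal (Real.exp (c * S ω)) ∂P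
        ≤ ∫⁻ ω, ENNReal.ofReal (Real.exp (c * A)) *
          ∏ j ∈ Finset.Icc 1 K, ENNReal.ofReal (Real.exp (c * β j * ‖w j ω‖ ^ 2)) ∂P := by
          refine lintegral_mono fun ω => ?_
          rw [← ENNReal.ofReal_prod_of_nonneg fun j _ => (Real.exp_pos _).le,
            ← ENNReal.ofReal_mul (Real.exp_pos _).le, ← Real.exp_sum, ← Real.exp_add]
          refine ENNReal.ofReal_le_ofReal (Real.exp_le_exp.2 ?_)
          refine (mul_le_mul_of_nonneg_left (hSle ω) hc0.le).trans (le_of_eq ?_)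
          rw [mul_add, Finset.mul_sum]
          simp_rw [mul_assoc]
      _ = ENNReal.ofReal (Real.exp (c * A)) * ∫⁻ ω,
          ∏ j ∈ Finset.Icc 1 K, ENNReal.ofReal (Real.exp (c * β j * ‖w j ω‖ ^ 2)) ∂P :=
          lintegral_const_mul' _ _ ENNReal.ofReal_ne_top
      _ ≤ ENNReal.ofReal B := by
          rw [hB, ENNReal.ofReal_mul (Real.exp_pos _).le]
          gcongr
  have hint : Integrable (fun ω => Real.exp (c * S ω)) P := by
    refine ⟨(by fun_prop : Measurable _).aestronglyMeasurable, ?_⟩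
    rw [hasFiniteIntegral_iff_ofReal (Filter.Eventually.of_forall fun ω => (Real.exp_pos _).le)]
    exact hbound.trans_lt ENNReal.ofReal_lt_top
  refine ⟨hint, ?_⟩
  have hB0 : 0 < B := mul_pos (Real.exp_pos _) (Finset.prod_pos hpos)
  have hI : ∫ ω, Real.exp (c * S ω) ∂P ≤ B := by
    rw [← ENNReal.ofReal_le_ofReal_iff hB0.le, ofReal_integral_eq_lintegral_ofReal hint
      (Filter.Eventually.of_forall fun ω => (Real.exp_pos _).le)]
    exact hbound
  have hlog : Real.log (∫ ω, Real.exp (c * S ω) ∂P) ≤ c * A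
      + ∑ j ∈ Finset.Icc 1 K, Real.log ((1 + θ * β j) / (1 - θ * β j)) := by
    refine (Real.log_le_log (integral_exp_pos hint) hI).trans (le_of_eq ?_)
    rw [hB, Real.log_mul (Real.exp_pos _).ne' (Finset.prod_pos hpos).ne', Real.log_exp,
      Real.log_prod fun j hj => (hpos j hj).ne']
  rw [riskCost, ← hc]
  refine (mul_le_mul_of_nonneg_left hlog (by positivity)).trans (le_of_eq ?_)
  rw [hc]
  field_simp

end IsSubGaussianNoise

end Probability

/-! ### The step-size parameters -/

section Parameters

variable {μ L α : ℝ}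

lemma gdRho_nonneg : 0 ≤ gdRho μ L α := (abs_nonneg _).trans (le_max_left _ _)

lemma gdRho_lt_one (hμ : 0 < μ) (hμL : μ < L) (hα : 0 < α) (hαL : α * L < 2) :
    gdRho μ L α < 1 := by
  have h1 : 0 < α * μ := mul_pos hα hμ
  have h2 : α * μ < α * L := mul_lt_mul_of_pos_left hμL hα
  refine max_lt ?_ ?_ <;> rw [abs_lt] <;> constructor <;> linarith

lemma gdS_pos (hL : 0 < L) (hα : 0 < α) (hαL : α * L < 2) : 0 < gdS L α := by
  unfold gdS
  split_ifs
  · exact zero_lt_one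
  · exact div_pos (by linarith) (mul_pos hα hL)

/-- The coefficient of the squared gradient norm that the one-step bound subtracts, once the cross
term with the noise has been absorbed. The choice of `gdS` keeps it nonnegative. -/
lemma gradient_coeff_nonneg (hL : 0 < L) (hα : 0 < α) (hαL : α * L < 2) :
    0 ≤ α * (1 - L * α / 2) - α * |1 - α * L| * gdS L α / 2 := by
  unfold gdS
  split_ifs with h
  · rw [le_div_iff₀ hL] at h
    rw [abs_of_nonneg (by linarith)]
    nlinarith
  · rw [not_le, div_lt_iff₀ hL] at h
    have h0 : 0 < α * L := mul_pos hα hL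
    rw [abs_of_neg (by linarith)]
    have : α * (1 - L * α / 2) - α * -(1 - α * L) * ((2 - α * L) / (α * L)) / 2
        = (2 - α * L) / (2 * L) := by field_simp; ring
    rw [this]
    exact div_nonneg (by linarith) (by linarith)

lemma gdGap_of_le (hL : 0 < L) (h : α ≤ 1 / L) : gdGap μ L α = α * μ := by
  unfold gdGap gdS
  rw [if_pos h]
  rw [le_div_iff₀ hL] at h
  rw [abs_of_nonneg (by linarith)]
  ring

lemma gdGap_of_lt (hL : 0 < L) (hα : 0 < α) (h : 1 / L < α) :
    gdGap μ L α = μ * (2 - α * L) / L := by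
  unfold gdGap gdS
  rw [if_neg (not_le.2 h)]
  rw [div_lt_iff₀ hL] at h
  rw [abs_of_neg (by linarith)]
  field_simp
  ring

lemma gdGap_mem_Ioo (hμ : 0 < μ) (hμL : μ < L) (hα : 0 < α) (hαL : α * L < 2) :
    gdGap μ L α ∈ Set.Ioo 0 1 := by
  have hL : 0 < L := hμ.trans hμL
  rcases le_or_gt α (1 / L) with h | h
  · rw [gdGap_of_le hL h]
    rw [le_div_iff₀ hL] at h
    exact ⟨mul_pos hα hμ, (mul_lt_mul_of_pos_left hμL hα).trans_le h⟩
  · rw [gdGap_of_lt hL hα h]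
    rw [div_lt_iff₀ hL] at h
    refine ⟨div_pos (mul_pos hμ (by linarith)) hL, ?_⟩
    rw [div_lt_one hL]
    nlinarith

/-- The factor of the squared noise norm in the one-step bound for the suboptimality. -/
lemma noise_coeff_pos (hL : 0 < L) (hα : 0 < α) (hαL : α * L < 2) :
    0 < α * (L / 2 * α + |1 - α * L| / (2 * gdS L α)) := by
  have := gdS_pos hL hα hαL
  positivity

/-- In the first two regimes of `gdHbar`, its square is the asymptotic coefficient of the
squared noise norms in the suboptimality bound. -/
lemma gdHbar_sq_of_le (hμ : 0 < μ) (hμL : μ < L) (hα : 0 < α) (hαL : α * L < 2)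
    (h : α ≤ 2 / (L + √(L * μ))) :
    gdHbar μ L α ^ 2 = α * (L / 2 * α + |1 - α * L| / (2 * gdS L α)) / gdGap μ L α := by
  have hL : 0 < L := hμ.trans hμL
  unfold gdHbar
  rcases le_or_gt α (1 / L) with h1 | h1
  · rw [gdGap_of_le hL h1, if_pos h1, gdS, if_pos h1, div_pow, Real.sq_sqrt (by positivity)]
    rw [le_div_iff₀ hL] at h1
    rw [abs_of_nonneg (by linarith)]
    field_simp
    ring
  · rw [gdGap_of_lt hL hα h1, if_neg (not_le.2 h1), gdS, if_neg (not_le.2 h1), if_pos h, mul_pow,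
      div_pow, Real.sq_sqrt (by positivity)]
    rw [div_lt_iff₀ hL] at h1
    rw [abs_of_neg (by linarith)]
    have h2 : 2 - α * L ≠ 0 := by linarith
    field_simp
    ring

/-- In the last two regimes of `gdHbar`, its square is the asymptotic coefficient of the
squared noise norms in the bound through the squared distances. -/
lemma gdHbar_sq_of_lt (hμ : 0 < μ) (hμL : μ < L) (hα : 0 < α)
    (h : 2 / (L + √(L * μ)) < α) :
    gdHbar μ L α ^ 2 = L * α ^ 2 / (2 * (1 - gdRho μ L α) ^ 2) := by
  have hL : 0 < L := hμ.trans hμL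
  have hsq : √(L * μ) < L := by
    rw [Real.sqrt_lt' hL]; nlinarith
  have h1 : 1 / L < α := by
    refine lt_trans ?_ h
    rw [div_lt_div_iff₀ hL (by positivity)]
    linarith
  unfold gdHbar
  rw [if_neg (not_le.2 h1), if_neg (not_le.2 h)]
  rw [div_lt_iff₀ hL] at h1
  unfold gdRho
  rw [abs_of_neg (show 1 - α * L < 0 by linarith)]
  split_ifs with h2
  · -- Here `α * (L + μ) ≤ 2`, so the maximum is attained at `μ`.
    rw [le_div_iff₀ (by positivity)] at h2
    rw [abs_of_nonneg (by nlinarith), max_eq_left (by linarith), mul_pow, div_pow,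
      Real.sq_sqrt (by positivity), Real.sq_sqrt (by positivity)]
    field_simp
    ring
  · rw [not_le, div_lt_iff₀ (by positivity)] at h2
    rw [max_eq_right (by rw [abs_le]; constructor <;> nlinarith), div_pow, mul_pow, mul_pow,
      Real.sq_sqrt hL.le, Real.sq_sqrt zero_le_two]
    ring_nf

lemma geom_div_le {q : ℝ} (hq0 : 0 ≤ q) (hq1 : q < 1) (n : ℕ) :
    (1 - q ^ n) / (1 - q) ≤ 1 / (1 - q) :=
  div_le_div_of_nonneg_right (by linarith [pow_nonneg hq0 n]) (sub_pos.2 hq1).le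

lemma geom_div_nonneg {q : ℝ} (hq0 : 0 ≤ q) (hq1 : q < 1) (n : ℕ) :
    0 ≤ (1 - q ^ n) / (1 - q) :=
  div_nonneg (sub_nonneg.2 (pow_le_one₀ hq0 hq1.le)) (sub_pos.2 hq1).le

lemma gdBound₁_lt_top (hρ : gdRho μ L α < 1) (hL : 0 < L) {σ θ D : ℝ} (hθ : 0 < θ)
    (h : θ * (L * α ^ 2 / (2 * (1 - gdRho μ L α) ^ 2)) < 1) (K : ℕ) :
    gdBound₁ μ L α σ θ D K < ⊤ := by
  unfold gdBound₁
  rw [if_pos]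
  · exact EReal.coe_lt_top _
  intro j _
  have h1 := geom_div_le gdRho_nonneg hρ (K - j + 1)
  rw [gdCoeff₁]
  generalize gdRho μ L α = ρ at *
  have h2 : 0 < 1 - ρ := sub_pos.2 hρ
  have h3 : θ * L * α ^ 2 / (1 - ρ) * ((1 - ρ ^ (K - j + 1)) / (1 - ρ))
      ≤ θ * L * α ^ 2 / (1 - ρ) * (1 / (1 - ρ)) := by gcongr
  have h4 : θ * L * α ^ 2 / (1 - ρ) * (1 / (1 - ρ))
      = 2 * (θ * (L * α ^ 2 / (2 * (1 - ρ) ^ 2))) := by field_simp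
  linarith

lemma gdBound₂_lt_top (hδ : gdGap μ L α ∈ Set.Ioo 0 1) {σ θ Δ : ℝ} (hθ : 0 < θ)
    (hr : 0 < α * (L / 2 * α + |1 - α * L| / (2 * gdS L α)))
    (h : θ * (α * (L / 2 * α + |1 - α * L| / (2 * gdS L α)) / gdGap μ L α) < 1) (K : ℕ) :
    gdBound₂ μ L α σ θ Δ K < ⊤ := by
  unfold gdBound₂
  rw [if_pos]
  · exact EReal.coe_lt_top _
  intro j _
  have h1 := geom_div_le (q := 1 - gdGap μ L α) (by linarith [hδ.2]) (by linarith [hδ.1])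
    (K - j + 1)
  rw [sub_sub_cancel] at h1
  rw [gdCoeff₂]
  have h3 := mul_le_mul_of_nonneg_left h1 (mul_pos hθ hr).le
  have h4 : θ * (α * (L / 2 * α + |1 - α * L| / (2 * gdS L α))) * (1 / gdGap μ L α)
      = θ * (α * (L / 2 * α + |1 - α * L| / (2 * gdS L α)) / gdGap μ L α) := by ring
  linarith

end Parameters

/-! ### Risk bounds for noisy gradient descent -/

section Risk

variable {d : ℕ} {Ω : Type*} [MeasurableSpace Ω] {P : Measure Ω} [IsProbabilityMeasure P]
  {μ L α σ θ : ℝ} {f : EuclideanSpace ℝ (Fin d) → ℝ} {x₀ xstar : EuclideanSpace ℝ (Fin d)}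
  {w : ℕ → Ω → EuclideanSpace ℝ (Fin d)}

lemma measurable_gdIter (hf : IsStronglyConvexSmooth μ L f) (hw : ∀ k, Measurable (w (k + 1)))
    (k : ℕ) : Measurable (gdIter f α x₀ w k) := by
  induction k with
  | zero => exact measurable_const
  | succ k ih =>
    have h1 := hw k
    have h2 := hf.continuous_gradient.measurable.comp ih
    exact ih.sub ((h2.add h1).const_smul α)

lemma measurable_cumSubopt (hf : IsStronglyConvexSmooth μ L f)
    (hw : ∀ k, Measurable (w (k + 1))) (c : ℝ) (K : ℕ) :
    Measurable (cumSubopt f c (gdIter f α x₀ w) K) :=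
  Finset.measurable_fun_sum _ fun k _ =>
    (hf.differentiable.continuous.measurable.comp (measurable_gdIter hf hw k)).sub_const c

/-- The risk bound obtained by following the squared distance to the minimizer. -/
lemma riskCost_le_gdBound₁ (hμ : 0 < μ) (hμL : μ < L) (hσ : 0 < σ) (hθ : 0 < θ)
    (hf : IsStronglyConvexSmooth μ L f) (hx : IsMinOn f Set.univ xstar) (hα : 0 < α)
    (hαL : α * L < 2) (hw : IsSubGaussianNoise P (gdIter f α x₀ w) w σ) (K : ℕ)
    (h : gdBound₁ μ L α σ θ (‖x₀ - xstar‖ ^ 2) K < ⊤) :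
    Integrable
        (fun ω => Real.exp (θ / (2 * σ ^ 2) * cumSubopt f (f xstar) (gdIter f α x₀ w) K ω)) P ∧
      (riskCost P (cumSubopt f (f xstar) (gdIter f α x₀ w) K) σ θ K : EReal)
        ≤ gdBound₁ μ L α σ θ (‖x₀ - xstar‖ ^ 2) K := by
  have hL : 0 < L := hμ.trans hμL
  have hρ0 : 0 ≤ gdRho μ L α := gdRho_nonneg
  have hρ1 := gdRho_lt_one hμ hμL hα hαL
  have h1ρ : 0 < 1 - gdRho μ L α := sub_pos.2 hρ1
  unfold gdBound₁ at h ⊢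
  split_ifs at h ⊢ with hpos
  · set β : ℕ → ℝ := fun j => L / 2 * (gdCoeff₁ μ L α K j * (α ^ 2 / (1 - gdRho μ L α))) with hβ
    have hθβ : ∀ j, θ * L * α ^ 2 / (1 - gdRho μ L α) * gdCoeff₁ μ L α K j = 2 * (θ * β j) :=
      fun j => by rw [hβ]; ring
    simp_rw [hθβ] at hpos ⊢
    have hquot : ∀ j, (2 + 2 * (θ * β j)) / (2 - 2 * (θ * β j)) = (1 + θ * β j) / (1 - θ * β j) :=
      fun j => by
        rw [← mul_div_mul_left (1 + θ * β j) (1 - θ * β j) two_ne_zero]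
        ring_nf
    simp_rw [hquot]
    obtain ⟨hint, hle⟩ := hw.integrable_and_riskCost_le (measurable_gdIter hf hw.measurable) hσ hθ
      (measurable_cumSubopt hf hw.measurable (f xstar) K) (K := K) (β := β)
      (A := L / 2 * ((1 - gdRho μ L α ^ (K + 1)) / (1 - gdRho μ L α) * ‖x₀ - xstar‖ ^ 2))
      (fun j _ => by
        have := geom_div_nonneg hρ0 hρ1 (K - j + 1)
        simp only [hβ, gdCoeff₁]
        positivity)
      (fun j hj => by linarith [hpos j hj])
      (fun ω => by
        have hsum := sum_le_of_linear_recursion (V := fun k => ‖gdIter f α x₀ w k ω - xstar‖ ^ 2)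
          (W := fun j => ‖w j ω‖ ^ 2) hρ0 hρ1
          (fun k => hf.norm_noisy_step_sq_le hμL hα hρ0 hρ1 hx _ _) K
        calc cumSubopt f (f xstar) (gdIter f α x₀ w) K ω
            ≤ ∑ k ∈ Finset.range (K + 1), L / 2 * ‖gdIter f α x₀ w k ω - xstar‖ ^ 2 :=
              Finset.sum_le_sum fun k _ => hf.sub_le_norm_sq hx _
          _ = L / 2 * ∑ k ∈ Finset.range (K + 1), ‖gdIter f α x₀ w k ω - xstar‖ ^ 2 :=
              (Finset.mul_sum _ _ _).symm
          _ ≤ L / 2 * _ := mul_le_mul_of_nonneg_left hsum (by positivity)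
          _ = _ := by
              rw [mul_add, Finset.mul_sum]
              congr 1
              refine Finset.sum_congr rfl fun j _ => ?_
              simp only [hβ, gdCoeff₁]
              ring)
    refine ⟨hint, EReal.coe_le_coe_iff.2 (hle.trans (le_of_eq ?_))⟩
    field_simp
    ring
  · exact absurd h (lt_irrefl _)

/-- The risk bound obtained by following the suboptimality. -/
lemma riskCost_le_gdBound₂ (hμ : 0 < μ) (hμL : μ < L) (hσ : 0 < σ) (hθ : 0 < θ)
    (hf : IsStronglyConvexSmooth μ L f) (hα : 0 < α)
    (hαL : α * L < 2) (hw : IsSubGaussianNoise P (gdIter f α x₀ w) w σ) (K : ℕ)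
    (h : gdBound₂ μ L α σ θ (f x₀ - f xstar) K < ⊤) :
    Integrable
        (fun ω => Real.exp (θ / (2 * σ ^ 2) * cumSubopt f (f xstar) (gdIter f α x₀ w) K ω)) P ∧
      (riskCost P (cumSubopt f (f xstar) (gdIter f α x₀ w) K) σ θ K : EReal)
        ≤ gdBound₂ μ L α σ θ (f x₀ - f xstar) K := by
  have hL : 0 < L := hμ.trans hμL
  have hs := gdS_pos hL hα hαL
  have hcoef := gradient_coeff_nonneg hL hα hαL
  have hδ := gdGap_mem_Ioo hμ hμL hα hαL
  have hr := noise_coeff_pos hL hα hαL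
  have hq0 : 0 ≤ 1 - gdGap μ L α := by linarith [hδ.2]
  have hq1 : 1 - gdGap μ L α < 1 := by linarith [hδ.1]
  unfold gdBound₂ at h ⊢
  split_ifs at h ⊢ with hpos
  · simp_rw [mul_assoc θ] at hpos ⊢
    obtain ⟨hint, hle⟩ := hw.integrable_and_riskCost_le (measurable_gdIter hf hw.measurable) hσ hθ
      (measurable_cumSubopt hf hw.measurable (f xstar) K) (K := K)
      (β := fun j => gdCoeff₂ μ L α K j * (α * (L / 2 * α + |1 - α * L| / (2 * gdS L α))))
      (A := (1 - (1 - gdGap μ L α) ^ (K + 1)) / gdGap μ L α * (f x₀ - f xstar))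
      (fun j _ => by
        have := geom_div_nonneg hq0 hq1 (K - j + 1)
        rw [sub_sub_cancel] at this
        exact mul_nonneg this hr.le)
      hpos
      (fun ω => by
        have hsum := sum_le_of_linear_recursion
          (V := fun k => f (gdIter f α x₀ w k ω) - f xstar) (W := fun j => ‖w j ω‖ ^ 2) hq0 hq1
          (fun k => hf.noisy_step_sub_le hμ hα hs hcoef _ _ _) K
        rwa [sub_sub_cancel] at hsum)
    exact ⟨hint, EReal.coe_le_coe_iff.2 hle⟩
  · exact absurd h (lt_irrefl _)

end Risk

theorem mainTheorem11 {d : ℕ} {Ω : Type*} [MeasurableSpace Ω] (P : Measure Ω)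
    [IsProbabilityMeasure P] (μ L α σ θ : ℝ) (hμ : 0 < μ) (hμL : μ < L) (hσ : 0 < σ)
    (f : EuclideanSpace ℝ (Fin d) → ℝ) (hf : IsStronglyConvexSmooth μ L f)
    (x₀ xstar : EuclideanSpace ℝ (Fin d)) (hxstar : IsMinOn f Set.univ xstar)
    (hα : α ∈ Set.Ioo 0 (2 / L))
    (w : ℕ → Ω → EuclideanSpace ℝ (Fin d))
    (hw : IsSubGaussianNoise P (gdIter f α x₀ w) w σ)
    (K : ℕ) (hθ : θ ∈ Set.Ioo 0 (1 / gdHbar μ L α ^ 2)) :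
    Integrable
        (fun ω => Real.exp (θ / (2 * σ ^ 2) * cumSubopt f (f xstar) (gdIter f α x₀ w) K ω)) P ∧
      (riskCost P (cumSubopt f (f xstar) (gdIter f α x₀ w) K) σ θ K : EReal)
        ≤ min (gdBound₁ μ L α σ θ (‖x₀ - xstar‖ ^ 2) K)
            (gdBound₂ μ L α σ θ (f x₀ - f xstar) K) ∧
      min (gdBound₁ μ L α σ θ (‖x₀ - xstar‖ ^ 2) K)
          (gdBound₂ μ L α σ θ (f x₀ - f xstar) K) < ⊤ := by
  obtain ⟨hα0, hαL⟩ := hα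
  obtain ⟨hθ0, hθ1⟩ := hθ
  have hL : 0 < L := hμ.trans hμL
  rw [lt_div_iff₀ hL] at hαL
  -- `1 / gdHbar ^ 2` exceeds `θ > 0`, so `gdHbar` cannot vanish.
  have hθH : θ * gdHbar μ L α ^ 2 < 1 := by
    have hH : 0 < 1 / gdHbar μ L α ^ 2 := hθ0.trans hθ1
    rwa [lt_div_iff₀ (one_div_pos.1 hH)] at hθ1
  have hfin : min (gdBound₁ μ L α σ θ (‖x₀ - xstar‖ ^ 2) K)
      (gdBound₂ μ L α σ θ (f x₀ - f xstar) K) < ⊤ := by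
    rcases le_or_gt α (2 / (L + √(L * μ))) with h | h
    · rw [gdHbar_sq_of_le hμ hμL hα0 hαL h] at hθH
      exact min_lt_of_right_lt (gdBound₂_lt_top (gdGap_mem_Ioo hμ hμL hα0 hαL) hθ0
        (noise_coeff_pos hL hα0 hαL) hθH K)
    · rw [gdHbar_sq_of_lt hμ hμL hα0 h] at hθH
      exact min_lt_of_left_lt (gdBound₁_lt_top (gdRho_lt_one hμ hμL hα0 hαL) hL hθ0 hθH K)
  have h1 := riskCost_le_gdBound₁ hμ hμL hσ hθ0 hf hxstar hα0 hαL hw K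
  have h2 := riskCost_le_gdBound₂ (xstar := xstar) hμ hμL hσ hθ0 hf hα0 hαL hw K
  refine ⟨?_, le_min ?_ ?_, hfin⟩
  · rcases min_lt_iff.1 hfin with h | h
    · exact (h1 h).1
    · exact (h2 h).1
  · rcases (le_top (a := gdBound₁ μ L α σ θ (‖x₀ - xstar‖ ^ 2) K)).lt_or_eq with h | h
    · exact (h1 h).2
    · exact h ▸ le_top
  · rcases (le_top (a := gdBound₂ μ L α σ θ (f x₀ - f xstar) K)).lt_or_eq with h | h
    · exact (h2 h).2
    · exact h ▸ le_top
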